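/- Let $k,m,n$ be positive integers and $[k]=\{1,\dots,k\}$. An $m$-dimensional variable word over $[k]$ of length $n$ is a sequence $w=(x_0,\dots,x_{n-1})$ in $[k]\cup\{v_0,\dots,v_{m-1}\}$, where $v_0,\dots,v_{m-1}$ are distinct symbols not in $[k]$, such that each $v_j$ occurs at least once and $\max\{i:x_i=v_j\}<\min\{i:x_i=v_{j+1}\}$ for all $0\le j<m-1$. A $1$-dimensional variable word is called simply a variable word. For a variable word $\mathbf{y}=(y_0,\dots,y_{m-1})$ over $[k]$ of length $m$, let $w(\mathbf{y})$ be the variable word of length $n$ obtained from $w$ by replacing each occurrence of $v_j$ by $y_j$, for all $0\le j<m$; the variable words of this form are said to be reduced by $w$. Theorem. For every triple of positive integers $k,r,m$ there exists a positive integer $n_0$ with the following property: for every integer $n\ge n_0$ and every $r$-coloring of all the variable words over $[k]$ of length $n$, there exists an $m$-dimensional variable word $w$ over $[k]$ of length $n$ such that the set of all variable words over $[k]$ reduced by $w$ is monochromatic. Denote the least such $n_0$ by $GR(k,m,r)$. Moreover, there is a primitive recursive function $f:\mathbb{N}^3\to\mathbb{N}$ belonging to the class $\mathcal{E}^5$ of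 Grzegorczyk's hierarchy such that $GR(k,m,r)\le f(k,m,r)$ for all positive integers $k,m,r$. Here $\mathcal{E}^N$ is the least class of functions $\mathbb{N}^a\to\mathbb{N}$ that contains the zero functions, the successor function, the projections and the functions $E_i$ for $0\le i<N$, and is closed under composition and limited recursion, where $E_0(x,y)=x+y$, $E_1(x)=x^2+2$, and $E_{i+1}(0)=2$, $E_{i+1}(x+1)=E_i(E_{i+1}(x))$ for $i\ge1$. (Limited recursion is primitive recursion in which the resulting function is bounded pointwise by a function already in the class.) -/

import Mathlib

/-- An `m`-dimensional variable word over the alphabet `Fin k` of length `n`: a sequence of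
letters (`Sum.inl a`) and variables `v_0, …, v_{m-1}` (`Sum.inr j`), in which every variable
occurs and the variables are in block position: whenever `j < j'`, every occurrence of `v_j`
precedes every occurrence of `v_{j'}`. -/
structure VarWord (k m n : ℕ) where
  /-- The underlying sequence. -/
  seq : Fin n → Fin k ⊕ Fin m
  occurs : ∀ j : Fin m, ∃ i : Fin n, seq i = Sum.inr j
  block : ∀ (j j' : Fin m), j < j' →
    ∀ i i' : Fin n, seq i = Sum.inr j → seq i' = Sum.inr j' → i < i'

namespace VarWord

/-- The word `w(x)`: each occurrence of `v_j` in `w` is replaced by the `j`-th symbol of `x`. -/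
def subst {k m m' n : ℕ} (w : VarWord k m n) (x : VarWord k m' m) : VarWord k m' n where
  seq := fun i => Sum.elim Sum.inl x.seq (w.seq i)
  occurs := by
    intro j
    obtain ⟨p, hp⟩ := x.occurs j
    obtain ⟨i, hi⟩ := w.occurs p
    exact ⟨i, by simp [hi, hp]⟩
  block := by
    intro j j' hjj i i' hi hi'
    rcases hp : w.seq i with a | p
    · simp [hp] at hi
    rcases hq : w.seq i' with a | q
    · simp [hq] at hi'
    simp only [hp, Sum.elim_inr] at hi
    simp only [hq, Sum.elim_inr] at hi'
    exact w.block p q (x.block j j' hjj p q hi hi') i i' hp hq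

/-- The set of all (one-dimensional) variable words reduced by `w`. -/
def reduced {k m n : ℕ} (w : VarWord k m n) : Set (VarWord k 1 n) :=
  {u | ∃ x : VarWord k 1 m, u = w.subst x}

end VarWord

/-- `n₀` has the property of the base case of the Graham–Rothschild theorem for `k, m, r`: for
every `n ≥ n₀` and every `r`-coloring of the variable words over `Fin k` of length `n`, there is an
`m`-dimensional variable word of length `n` whose reduced variable words all have one color. -/
def GRProperty (k m r n₀ : ℕ) : Prop :=
  ∀ n : ℕ, n₀ ≤ n → ∀ c : VarWord k 1 n → Fin r,
    ∃ w : VarWord k m n, ∃ color : Fin r, ∀ u ∈ w.reduced, c u = color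

/-- `GR(k, m, r)`: the least positive integer with the property above. -/
noncomputable def GR (k m r : ℕ) : ℕ :=
  sInf {n₀ : ℕ | 0 < n₀ ∧ GRProperty k m r n₀}

/-- The unary generating functions `E_1, E_2, …` of the Grzegorczyk hierarchy, where
`grzegorczykE i` is `E_{i+1}`: `E_1(x) = x² + 2`, and `E_{i+1}(0) = 2`,
`E_{i+1}(x + 1) = E_i(E_{i+1}(x))` for `i ≥ 1`. -/
def grzegorczykE : ℕ → ℕ → ℕ
  | 0, x => x ^ 2 + 2
  | _ + 1, 0 => 2
  | i + 1, x + 1 => grzegorczykE i (grzegorczykE (i + 1) x)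

/-- The class `ℰ^N` of the Grzegorczyk hierarchy: the least class of functions `ℕ^a → ℕ` that
contains zero, successor, the projections and `E_i` for all `i < N`, where `E_0(x, y) = x + y`, and
is closed under composition and limited recursion (`ℰ^3` is the class of Kalmár elementary
functions). -/
inductive Grzegorczyk (N : ℕ) : ∀ {a : ℕ}, ((Fin a → ℕ) → ℕ) → Prop
  | zero {a : ℕ} : Grzegorczyk N (a := a) fun _ => 0
  | succ : Grzegorczyk N (a := 1) fun v => v 0 + 1
  | proj {a : ℕ} (i : Fin a) : Grzegorczyk N fun v => v i
  | add (h : 0 < N) : Grzegorczyk N (a := 2) fun v => v 0 + v 1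
  | gen (i : ℕ) (h : i + 1 < N) : Grzegorczyk N (a := 1) fun v => grzegorczykE i (v 0)
  | comp {a b : ℕ} {f : (Fin b → ℕ) → ℕ} {g : Fin b → (Fin a → ℕ) → ℕ} :
      Grzegorczyk N f → (∀ i, Grzegorczyk N (g i)) → Grzegorczyk N fun v => f fun i => g i v
  | limitedRec {a : ℕ} {g : (Fin a → ℕ) → ℕ} {h : (Fin (a + 2) → ℕ) → ℕ}
      {bd f : (Fin (a + 1) → ℕ) → ℕ} :
      Grzegorczyk N g → Grzegorczyk N h → Grzegorczyk N bd →
      (∀ x, f (Matrix.vecCons 0 x) = g x) →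
      (∀ t x, f (Matrix.vecCons (t + 1) x) =
        h (Matrix.vecCons t (Matrix.vecCons (f (Matrix.vecCons t x)) x))) →
      (∀ v, f v ≤ bd v) → Grzegorczyk N f

/-!
The proof is by induction on the size of the alphabet, starting from a single letter.

*One letter.* Words over a one-letter alphabet are sets of positions, and the assertion is the
finite unions theorem for sets `F₀ < F₁ < ⋯` in block position. By Ramsey's theorem
(`exists_homogeneous`) one may assume that the colour of a set depends only on its size. Hilbert's
cube lemma for the induced colouring of the integers (`exists_hilbertCube`) provides sizes
`a, d₀, d₁, …` such that all sums `a + ∑ i ∈ I, d i` have the colour of `a`; consecutive intervals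
of these sizes form blocks for which adding later blocks to the first one does not change its
colour (`exists_block_stable_first`). Repeating this with the later blocks in the role of the
points, one gets blocks for which the colour of a union is determined by its first block
(`exists_block_min_determined`), and the pigeonhole principle finishes the case
(`exists_block_monochromatic`).

*Adding a letter.* Shelah's argument: among the words `a ⋯ a b ⋯ b` of large length two have the
same colour in every context, so on a block `a ⋯ a v ⋯ v b ⋯ b` it does not matter whether `v` is
replaced by `a` or by `b`. Doing this in `M` successive blocks gives an `M`-dimensional subspace on
which the colouring does not distinguish `a` from `b` (`exists_insensitive`), hence is determined
by the words over the alphabet without `b` (`HasMonoSubspace.exists_succ`).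

*Bounds.* Each step of the iteration and of the induction costs boundedly many applications of the
tower function `E_3`, the number of steps is polynomial in `k, m, r`, and iterates of `E_3` are
dominated by `E_4`
(`iterate_grzegorczykE_le`). So `E_4` of a polynomial, itself a composition of generators of `ℰ^5`,
is an upper bound. In Lean, `grzegorczykE i` is `E_{i+1}`.
-/

/-! ### Growth of the Grzegorczyk generators -/

theorem grzegorczykE_growth (i : ℕ) :
    StrictMono (grzegorczykE i) ∧ ∀ x, x < grzegorczykE i x := by
  induction i with
  | zero =>
    refine ⟨fun x y h => ?_, fun x => ?_⟩
    · simp only [grzegorczykE]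
      gcongr
    · simp only [grzegorczykE]
      nlinarith [Nat.zero_le (x * x)]
  | succ i ih =>
    have hm : StrictMono (grzegorczykE (i + 1)) :=
      strictMono_nat_of_lt_succ fun x => by
        simpa only [grzegorczykE] using ih.2 (grzegorczykE (i + 1) x)
    refine ⟨hm, fun x => ?_⟩
    induction x with
    | zero => simp [grzegorczykE]
    | succ x hx => exact lt_of_le_of_lt hx (hm x.lt_succ_self)

theorem grzegorczykE_mono (i : ℕ) : Monotone (grzegorczykE i) :=
  (grzegorczykE_growth i).1.monotone

theorem lt_grzegorczykE (i x : ℕ) : x < grzegorczykE i x :=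
  (grzegorczykE_growth i).2 x

theorem iterate_grzegorczykE_mono (i j : ℕ) : Monotone ((grzegorczykE i)^[j]) :=
  (grzegorczykE_mono i).iterate j

theorem le_iterate_grzegorczykE (i j x : ℕ) : x ≤ (grzegorczykE i)^[j] x :=
  Function.id_le_iterate_of_id_le (fun y => (lt_grzegorczykE i y).le) j x

/-- Iterating `E_{i+1}` is dominated by a single application of `E_{i+2}`. -/
theorem iterate_grzegorczykE_le (i j x : ℕ) :
    (grzegorczykE i)^[j] x ≤ grzegorczykE (i + 1) (x + j) := by
  have key : ∀ j, grzegorczykE (i + 1) (x + j) = (grzegorczykE i)^[j] (grzegorczykE (i + 1) x) := by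
    intro j
    induction j with
    | zero => rfl
    | succ j ih => rw [Function.iterate_succ_apply', ← ih, ← add_assoc, grzegorczykE]
  rw [key]
  exact iterate_grzegorczykE_mono i j (lt_grzegorczykE _ x).le

theorem two_pow_two_pow_le (x : ℕ) : 2 ^ 2 ^ x ≤ grzegorczykE 1 x := by
  induction x with
  | zero => simp [grzegorczykE]
  | succ x ih =>
    have : grzegorczykE 1 (x + 1) = grzegorczykE 1 x ^ 2 + 2 := by simp [grzegorczykE]
    rw [this, pow_succ 2 x, pow_mul]
    exact (Nat.pow_le_pow_left ih 2).trans (Nat.le_add_right _ _)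

theorem pow_self_le (x : ℕ) : x ^ x ≤ grzegorczykE 1 x := by
  refine le_trans ?_ (two_pow_two_pow_le x)
  cases x with
  | zero => simp
  | succ x =>
    have h1 : x + 1 ≤ 2 ^ x := x.lt_two_pow_self
    have h2 : x * (x + 1) ≤ 2 ^ (x + 1) := by
      clear h1
      induction x with
      | zero => simp
      | succ x ih =>
        have h1 : x + 1 ≤ 2 ^ x := x.lt_two_pow_self
        have h3 : 2 ^ (x + 1 + 1) = 2 * 2 ^ (x + 1) := by ring
        have h4 : 2 ^ (x + 1) = 2 * 2 ^ x := by ring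
        nlinarith
    calc (x + 1) ^ (x + 1) ≤ (2 ^ x) ^ (x + 1) := Nat.pow_le_pow_left h1 _
      _ = 2 ^ (x * (x + 1)) := by rw [pow_mul]
      _ ≤ 2 ^ 2 ^ (x + 1) := Nat.pow_le_pow_right (by norm_num) h2

theorem pow_le_grzegorczykE {x y X : ℕ} (hx : x ≤ X) (hy : y ≤ X) :
    x ^ y ≤ grzegorczykE 1 X := by
  refine le_trans ?_ (pow_self_le X)
  rcases Nat.eq_zero_or_pos X with rfl | hX
  · simp_all
  · exact (Nat.pow_le_pow_left hx y).trans (Nat.pow_le_pow_right hX hy)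

theorem mul_le_grzegorczykE {x y X : ℕ} (hx : x ≤ X) (hy : y ≤ X) :
    x * y ≤ grzegorczykE 1 X := by
  refine (Nat.mul_le_mul hx hy).trans ?_
  cases X with
  | zero => simp
  | succ X =>
    have h := (grzegorczykE_growth 1).2 X
    have : grzegorczykE 1 (X + 1) = grzegorczykE 1 X ^ 2 + 2 := by simp [grzegorczykE]
    nlinarith

theorem add_le_grzegorczykE {x y X : ℕ} (hx : x ≤ X) (hy : y ≤ X) :
    x + y ≤ grzegorczykE 1 X := by
  cases X with
  | zero => simp_all
  | succ X =>
    have h := (grzegorczykE_growth 1).2 X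
    have : grzegorczykE 1 (X + 1) = grzegorczykE 1 X ^ 2 + 2 := by simp [grzegorczykE]
    nlinarith

theorem two_mul_le_grzegorczykE (x : ℕ) : 2 * x ≤ grzegorczykE 2 x := by
  induction x with
  | zero => simp
  | succ x ih =>
    have h1 : grzegorczykE 2 (x + 1) = grzegorczykE 1 (grzegorczykE 2 x) := by
      simp [grzegorczykE]
    have h2 := two_pow_two_pow_le (grzegorczykE 2 x)
    have h4 : grzegorczykE 2 x + 1 ≤ 2 ^ grzegorczykE 2 x := Nat.lt_two_pow_self
    have h5 : 2 ^ grzegorczykE 2 x + 1 ≤ 2 ^ 2 ^ grzegorczykE 2 x := Nat.lt_two_pow_self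
    omega

/-! ### Homogeneous sets -/

/-- Erdős–Rado: a large set contains a set `H` on which the colour of `insert y A` does not depend
on the choice of `y ∈ H` above the nonempty set `A ⊆ H`. -/
theorem exists_endHomogeneous (n : ℕ) : ∀ (R : ℕ), 2 ≤ R → ∀ (κ : Type) [Fintype κ],
    Fintype.card κ ≤ R → ∀ (c : Finset ℕ → κ) (S : Finset ℕ), R ^ 4 ^ n ≤ S.card →
    ∃ H ⊆ S, H.card = n ∧ ∀ A ⊆ H, A.Nonempty → ∀ y ∈ H, ∀ z ∈ H,
      (∀ a ∈ A, a < y) → (∀ a ∈ A, a < z) → c (insert y A) = c (insert z A) := by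
  classical
  induction n with
  | zero =>
    intro R _ κ _ _ c S _
    exact ⟨∅, by simp, by simp, fun A _ _ y hy => by simp at hy⟩
  | succ n ih =>
    intro R hR κ _ hκ c S hS
    have hSne : S.Nonempty := by
      rw [← Finset.card_pos]
      exact lt_of_lt_of_le (by positivity) hS
    set x := S.min' hSne
    have hxS : x ∈ S := S.min'_mem hSne
    have hxlt : ∀ y ∈ S.erase x, x < y := fun y hy => by
      have := S.min'_le y (Finset.mem_of_mem_erase hy)
      exact lt_of_le_of_ne this (Finset.ne_of_mem_erase hy).symm
    have hcard : R * (R ^ 2) ^ 4 ^ n ≤ (S.erase x).card := by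
      rw [Finset.card_erase_of_mem hxS]
      refine Nat.le_sub_one_of_lt (lt_of_lt_of_le ?_ hS)
      rw [← pow_mul, ← pow_succ']
      refine Nat.pow_lt_pow_right hR ?_
      have : 1 ≤ 4 ^ n := Nat.one_le_pow _ _ (by norm_num)
      rw [pow_succ]; omega
    obtain ⟨col, -, hcol⟩ := Finset.exists_le_card_fiber_of_mul_le_card_of_maps_to
      (s := S.erase x) (t := Finset.univ) (f := fun y => c {y, x}) (n := (R ^ 2) ^ 4 ^ n)
      (by simp) ⟨c ∅, by simp⟩
      (by rw [Finset.card_univ]; exact (Nat.mul_le_mul_right _ hκ).trans hcard)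
    obtain ⟨H, hHS, hHc, hH⟩ := ih (R ^ 2) (by nlinarith) (κ × κ)
      (by rw [Fintype.card_prod]; nlinarith) (fun A => (c A, c (insert x A))) _ hcol
    have hHS' : ∀ y ∈ H, x < y ∧ c {y, x} = col := fun y hy => by
      have := Finset.mem_filter.1 (hHS hy)
      exact ⟨hxlt y this.1, this.2⟩
    have hxH : x ∉ H := fun h => lt_irrefl _ (hHS' x h).1
    refine ⟨insert x H, ?_, by rw [Finset.card_insert_of_notMem hxH, hHc], ?_⟩
    · intro y hy
      rcases Finset.mem_insert.1 hy with rfl | hy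
      · exact hxS
      · exact Finset.mem_of_mem_erase (Finset.mem_filter.1 (hHS hy)).1
    intro A hA hne y hy z hz hAy hAz
    -- an element above the nonempty set `A ⊆ insert x H` is not the minimum `x`
    have hup : ∀ y ∈ insert x H, (∀ a ∈ A, a < y) → y ∈ H := by
      intro y hy hAy
      rcases Finset.mem_insert.1 hy with rfl | hy
      · obtain ⟨a, ha⟩ := hne
        rcases Finset.mem_insert.1 (hA ha) with h | h
        · exact absurd (hAy a ha) (by rw [h]; exact lt_irrefl _)
        · exact absurd (hAy a ha) (hHS' a h).1.not_gt
      · exact hy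
    have hyH := hup y hy hAy
    have hzH := hup z hz hAz
    by_cases hxA : x ∈ A
    · rcases (A.erase x).eq_empty_or_nonempty with h0 | h0
      · have : A = {x} := by rw [← Finset.insert_erase hxA, h0]; rfl
        rw [this]
        exact (hHS' y hyH).2.trans (hHS' z hzH).2.symm
      · have := hH (A.erase x)
          (fun a ha => (Finset.mem_insert.1 (hA (Finset.mem_of_mem_erase ha))).resolve_left
            (Finset.ne_of_mem_erase ha)) h0 y hyH z hzH
          (fun a ha => hAy a (Finset.mem_of_mem_erase ha))
          (fun a ha => hAz a (Finset.mem_of_mem_erase ha))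
        have := congrArg Prod.snd this
        simpa only [Finset.insert_comm x _ _, Finset.insert_erase hxA] using this
    · have := hH A
          (fun a ha => (Finset.mem_insert.1 (hA ha)).resolve_left
            (fun h => hxA (h ▸ ha))) hne y hyH z hzH hAy hAz
      exact congrArg Prod.fst this

/-- Ramsey's theorem for all sizes up to `d` at once, with a tower-type bound. -/
theorem exists_homogeneous_le (R : ℕ) (hR : 2 ≤ R) (N d : ℕ) :
    ∃ n ≤ (grzegorczykE 1)^[5 * d] (N + R), ∀ (κ : Type) [Fintype κ], Fintype.card κ ≤ R →
      ∀ (c : Finset ℕ → κ) (S : Finset ℕ), n ≤ S.card → ∃ H ⊆ S, H.card = N ∧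
        ∀ A ⊆ H, ∀ B ⊆ H, A.card = B.card → A.card ≤ d → c A = c B := by
  classical
  induction d with
  | zero =>
    refine ⟨N, by simp, fun κ _ _ c S hS => ?_⟩
    obtain ⟨H, hH, hc⟩ := Finset.exists_subset_card_eq hS
    refine ⟨H, hH, hc, fun A _ B _ hAB hA => ?_⟩
    rw [Finset.card_eq_zero.1 (Nat.le_zero.1 hA),
      Finset.card_eq_zero.1 (hAB ▸ Nat.le_zero.1 hA : B.card = 0)]
  | succ d ih =>
    obtain ⟨u, hu, ih⟩ := ih
    refine ⟨R * R ^ 4 ^ (u + 1), ?_, fun κ _ hκ c S hS => ?_⟩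
    · rw [show 5 * (d + 1) = 5 + 5 * d by ring, Function.iterate_add_apply]
      set X := (grzegorczykE 1)^[5 * d] (N + R)
      have hRX : R ≤ X := le_trans (by omega) (le_iterate_grzegorczykE 1 (5 * d) (N + R))
      have h1 : u + 1 ≤ grzegorczykE 1 X := add_le_grzegorczykE hu (by omega)
      have hX1 := (lt_grzegorczykE 1 X).le
      set X1 := grzegorczykE 1 X
      have hX2 := (lt_grzegorczykE 1 X1).le
      -- `4 = 2 ^ 2` is at most `E_2(X₁)`, as `X₁ ≥ 2`
      have h4 : 4 ≤ grzegorczykE 1 X1 :=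
        le_trans (by norm_num) (pow_le_grzegorczykE (x := 2) (y := 2) (X := X1)
          (by omega) (by omega))
      set X2 := grzegorczykE 1 X1
      have h2 : 4 ^ (u + 1) ≤ grzegorczykE 1 X2 := pow_le_grzegorczykE h4 (by omega)
      have hX3 := (lt_grzegorczykE 1 X2).le
      have h3 : R ^ 4 ^ (u + 1) ≤ grzegorczykE 1 (grzegorczykE 1 X2) :=
        pow_le_grzegorczykE (by omega) h2
      have hX4 := (lt_grzegorczykE 1 (grzegorczykE 1 X2)).le
      change _ ≤ grzegorczykE 1 (grzegorczykE 1 (grzegorczykE 1 X2))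
      exact mul_le_grzegorczykE (by omega) h3
    · obtain ⟨col, -, hcol⟩ := Finset.exists_le_card_fiber_of_mul_le_card_of_maps_to
        (s := S) (t := Finset.univ) (f := fun y => c {y}) (n := R ^ 4 ^ (u + 1))
        (by simp) ⟨c ∅, by simp⟩
        (by rw [Finset.card_univ]; exact (Nat.mul_le_mul_right _ hκ).trans hS)
      obtain ⟨H₁, hH₁S, hH₁c, hH₁⟩ := exists_endHomogeneous (u + 1) R hR κ hκ c _ hcol
      have hne : H₁.Nonempty := by rw [← Finset.card_pos]; omega
      set t := H₁.max' hne
      have htH : t ∈ H₁ := H₁.max'_mem hne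
      obtain ⟨H, hHS, hHc, hH⟩ := ih κ hκ (fun A => c (insert t A)) (H₁.erase t)
        (by rw [Finset.card_erase_of_mem htH]; omega)
      have hlt : ∀ a ∈ H, a < t := fun a ha =>
        lt_of_le_of_ne (H₁.le_max' a (Finset.mem_of_mem_erase (hHS ha)))
          (Finset.ne_of_mem_erase (hHS ha))
      have hHH₁ : H ⊆ H₁ := hHS.trans (Finset.erase_subset _ _)
      have hsing : ∀ y ∈ H₁, c {y} = col := fun y hy => (Finset.mem_filter.1 (hH₁S hy)).2
      -- the maximum of `A` may be replaced by `t`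
      have hrepl : ∀ A ⊆ H, A.Nonempty → ∃ A' ⊆ H, A'.card + 1 = A.card ∧
          c A = c (insert t A') := by
        intro A hA hne
        set a := A.max' hne
        have haA : a ∈ A := A.max'_mem hne
        refine ⟨A.erase a, (Finset.erase_subset _ _).trans hA,
          Finset.card_erase_add_one haA, ?_⟩
        nth_rewrite 1 [← Finset.insert_erase haA]
        rcases (A.erase a).eq_empty_or_nonempty with h0 | h0
        · rw [h0]
          exact (hsing a (hHH₁ (hA haA))).trans (hsing t htH).symm
        · refine hH₁ _ ((Finset.erase_subset _ _).trans (hA.trans hHH₁)) h0 a (hHH₁ (hA haA))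
            t htH (fun b hb => ?_) (fun b hb => hlt b (hA (Finset.mem_of_mem_erase hb)))
          exact lt_of_le_of_ne (A.le_max' b (Finset.mem_of_mem_erase hb))
            (Finset.ne_of_mem_erase hb)
      refine ⟨H, fun y hy => (Finset.mem_filter.1 (hH₁S (hHH₁ hy))).1, hHc, ?_⟩
      intro A hA B hB hAB hAd
      rcases A.eq_empty_or_nonempty with rfl | hAne
      · rw [Finset.card_empty] at hAB
        rw [Finset.card_eq_zero.1 hAB.symm]
      · have hBne : B.Nonempty := by
          rw [← Finset.card_pos, ← hAB, Finset.card_pos]; exact hAne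
        obtain ⟨A', hA', hAc, hcA⟩ := hrepl A hA hAne
        obtain ⟨B', hB', hBc, hcB⟩ := hrepl B hB hBne
        rw [hcA, hcB]
        exact hH A' hA' B' hB' (by omega) (by omega)

/-- Ramsey's theorem in terms of an enumeration: for suitable `n` one finds `G` points of
`{0, …, n - 1}`, listed increasingly by `h`, such that the colour of a set of these points depends
only on its size. -/
theorem exists_homogeneous (R : ℕ) (hR : 2 ≤ R) (G : ℕ) :
    ∃ n ≤ grzegorczykE 2 (6 * G + R), ∀ (κ : Type) [Fintype κ], Fintype.card κ ≤ R →
      ∀ c : Finset ℕ → κ, ∃ h : ℕ → ℕ, (∀ i < G, h i < n) ∧ (∀ i j, i < j → j < G → h i < h j) ∧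
        ∀ A ⊆ Finset.range G, ∀ B ⊆ Finset.range G, A.card = B.card →
          c (A.image h) = c (B.image h) := by
  classical
  obtain ⟨n, hn, H⟩ := exists_homogeneous_le R hR G G
  refine ⟨n, hn.trans ((iterate_grzegorczykE_le 1 _ _).trans
    (grzegorczykE_mono 2 (by omega))), fun κ _ hκ c => ?_⟩
  obtain ⟨H, hHS, hHc, hH⟩ := H κ hκ c (Finset.range n) (by simp)
  set h : ℕ → ℕ := fun i => if hi : i < G then H.orderEmbOfFin hHc ⟨i, hi⟩ else 0 with hh
  have hval : ∀ i (hi : i < G), h i = H.orderEmbOfFin hHc ⟨i, hi⟩ := fun i hi => by simp [hh, hi]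
  have hmem : ∀ i < G, h i ∈ H := fun i hi => by
    rw [hval i hi]; exact H.orderEmbOfFin_mem hHc _
  have hlt : ∀ i j, i < j → j < G → h i < h j := fun i j hij hj => by
    rw [hval i (hij.trans hj), hval j hj]
    exact (H.orderEmbOfFin hHc).strictMono hij
  have hinj : Set.InjOn h (Finset.range G) := by
    intro i hi j hj hij
    simp only [Finset.coe_range, Set.mem_Iio] at hi hj
    rcases lt_trichotomy i j with h1 | h1 | h1
    · exact absurd hij (hlt i j h1 hj).ne
    · exact h1
    · exact absurd hij (hlt j i h1 hi).ne'
  refine ⟨h, fun i hi => Finset.mem_range.1 (hHS (hmem i hi)), hlt, fun A hA B hB hAB => ?_⟩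
  have himg : ∀ A ⊆ Finset.range G, A.image h ⊆ H ∧ (A.image h).card = A.card := fun A hA =>
    ⟨Finset.image_subset_iff.2 fun i hi => hmem i (Finset.mem_range.1 (hA hi)),
      Finset.card_image_of_injOn (hinj.mono (by exact_mod_cast hA))⟩
  refine hH _ (himg A hA).1 _ (himg B hB).1 ?_ ?_
  · rw [(himg A hA).2, (himg B hB).2, hAB]
  · rw [(himg A hA).2]
    simpa using Finset.card_le_card hA

/-- Hilbert's cube lemma with an explicit bound `G`. -/
theorem exists_hilbertCube (R : ℕ) (m : ℕ) :
    ∃ G ≤ grzegorczykE 2 (3 * m + R + 1), ∀ (κ : Type) [Fintype κ], Fintype.card κ ≤ R →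
      ∀ α : ℕ → κ, ∃ (a : ℕ) (d : ℕ → ℕ), 0 < a ∧ (∀ i < m, 0 < d i) ∧
        a + ∑ i ∈ Finset.range m, d i ≤ G ∧
        ∀ I ⊆ Finset.range m, α (a + ∑ i ∈ I, d i) = α a := by
  classical
  suffices h : ∃ G ≤ (grzegorczykE 1)^[3 * m] (R + 1), ∀ (κ : Type) [Fintype κ],
      Fintype.card κ ≤ R → ∀ α : ℕ → κ, ∃ (a : ℕ) (d : ℕ → ℕ), 0 < a ∧ (∀ i < m, 0 < d i) ∧
        a + ∑ i ∈ Finset.range m, d i ≤ G ∧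
        ∀ I ⊆ Finset.range m, α (a + ∑ i ∈ I, d i) = α a by
    obtain ⟨G, hG, h⟩ := h
    exact ⟨G, hG.trans ((iterate_grzegorczykE_le 1 _ _).trans
      (grzegorczykE_mono 2 (by omega))), h⟩
  induction m with
  | zero =>
    refine ⟨1, by simp, fun κ _ _ α => ⟨1, fun _ => 0, by simp, by simp, by simp, ?_⟩⟩
    intro I hI
    simp [Finset.subset_empty.1 (by simpa using hI : I ⊆ ∅)]
  | succ m ih =>
    obtain ⟨G, hG, ih⟩ := ih
    refine ⟨G + R ^ (G + 1), ?_, fun κ _ hκ α => ?_⟩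
    · rw [show 3 * (m + 1) = 3 + 3 * m by ring, Function.iterate_add_apply]
      set X := (grzegorczykE 1)^[3 * m] (R + 1)
      have hRX : R + 1 ≤ X := le_iterate_grzegorczykE 1 (3 * m) (R + 1)
      have h1 : G + 1 ≤ grzegorczykE 1 X := add_le_grzegorczykE hG (by omega)
      have hX1 := (lt_grzegorczykE 1 X).le
      have h2 : R ^ (G + 1) ≤ grzegorczykE 1 (grzegorczykE 1 X) :=
        pow_le_grzegorczykE (by omega) h1
      have hX2 := (lt_grzegorczykE 1 (grzegorczykE 1 X)).le
      exact add_le_grzegorczykE (by omega) h2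
    · -- two of the `R ^ (G + 1) + 1` shifts of `α` agree on `{0, …, G}`
      obtain ⟨s, hs, t, ht, hst, heq⟩ : ∃ s ∈ Finset.range (R ^ (G + 1) + 1),
          ∃ t ∈ Finset.range (R ^ (G + 1) + 1), s ≠ t ∧
            (fun x : Fin (G + 1) => α (x + s)) = fun x : Fin (G + 1) => α (x + t) := by
        refine Finset.exists_ne_map_eq_of_card_lt_of_maps_to
          (f := fun s => fun x : Fin (G + 1) => α (x + s)) (t := Finset.univ) ?_ (by simp)
        rw [Finset.card_univ, Fintype.card_fun, Fintype.card_fin, Finset.card_range]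
        exact Nat.lt_succ_of_le (Nat.pow_le_pow_left hκ _)
      wlog hlt : s < t generalizing s t
      · exact this t ht s hs hst.symm heq.symm (by omega)
      rw [Finset.mem_range] at ht
      obtain ⟨a, d, ha, hd, hsum, hmono⟩ := ih κ hκ fun x => α (x + s)
      have hshift : ∀ x ≤ G, α (x + s) = α (x + t) := fun x hx =>
        congrFun heq ⟨x, by omega⟩
      refine ⟨a + s, fun i => if i = m then t - s else d i, by omega, ?_, ?_, ?_⟩
      · intro i hi
        dsimp only
        split_ifs with h
        · omega
        · exact hd i (by omega)
      · have : ∑ i ∈ Finset.range m, (if i = m then t - s else d i) =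
            ∑ i ∈ Finset.range m, d i := by
          refine Finset.sum_congr rfl fun i hi => if_neg ?_
          rw [Finset.mem_range] at hi; omega
        rw [Finset.sum_range_succ, this, if_pos rfl]
        omega
      · intro I hI
        have hI' : I.erase m ⊆ Finset.range m := fun i hi => by
          have h1 := Finset.mem_range.1 (hI (Finset.mem_of_mem_erase hi))
          have h2 := Finset.ne_of_mem_erase hi
          rw [Finset.mem_range]; omega
        have hsumI : ∑ i ∈ I.erase m, (if i = m then t - s else d i) = ∑ i ∈ I.erase m, d i :=
          Finset.sum_congr rfl fun i hi => if_neg (Finset.ne_of_mem_erase hi)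
        have hle : a + ∑ i ∈ I.erase m, d i ≤ G :=
          (Nat.add_le_add_left (Finset.sum_le_sum_of_subset hI') a).trans hsum
        have h1 := hmono _ hI'
        have h2 := hshift _ hle
        by_cases hm : m ∈ I
        · rw [← Finset.add_sum_erase I _ hm, hsumI, if_pos rfl, ← h1, h2]
          congr 1
          omega
        · rw [Finset.erase_eq_of_notMem hm] at *
          rw [hsumI, ← h1]
          congr 1
          omega

/-! ### Finite unions in block position -/

/-- `F 0, …, F (m - 1)` are nonempty subsets of `{0, …, n - 1}` in block position: each lies
entirely to the left of the next. The values `F i` with `i ≥ m` are irrelevant. -/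
structure IsBlockSeq (F : ℕ → Finset ℕ) (m n : ℕ) : Prop where
  nonempty : ∀ i < m, (F i).Nonempty
  subset : ∀ i < m, F i ⊆ Finset.range n
  lt : ∀ i j, i < j → j < m → ∀ a ∈ F i, ∀ b ∈ F j, a < b

theorem IsBlockSeq.comp {F G : ℕ → Finset ℕ} {l m n : ℕ} (hF : IsBlockSeq F m n)
    (hG : IsBlockSeq G l m) : IsBlockSeq (fun j => (G j).biUnion F) l n where
  nonempty j hj := by
    obtain ⟨i, hi⟩ := hG.nonempty j hj
    obtain ⟨a, ha⟩ := hF.nonempty i (Finset.mem_range.1 (hG.subset j hj hi))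
    exact ⟨a, Finset.mem_biUnion.2 ⟨i, hi, ha⟩⟩
  subset j hj := Finset.biUnion_subset.2 fun i hi =>
    hF.subset i (Finset.mem_range.1 (hG.subset j hj hi))
  lt j j' hjj hj' a ha b hb := by
    obtain ⟨i, hi, ha⟩ := Finset.mem_biUnion.1 ha
    obtain ⟨i', hi', hb⟩ := Finset.mem_biUnion.1 hb
    exact hF.lt i i' (hG.lt j j' hjj hj' i hi i' hi')
      (Finset.mem_range.1 (hG.subset j' hj' hi')) a ha b hb

theorem IsBlockSeq.singleton {h : ℕ → ℕ} {m n : ℕ} (hn : ∀ i < m, h i < n)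
    (hlt : ∀ i j, i < j → j < m → h i < h j) : IsBlockSeq (fun i => {h i}) m n where
  nonempty i _ := Finset.singleton_nonempty _
  subset i hi := by simpa using hn i hi
  lt i j hij hj a ha b hb := by
    rw [Finset.mem_singleton.1 ha, Finset.mem_singleton.1 hb]
    exact hlt i j hij hj

/-- One can find blocks such that adding later blocks to the first one does not change its
colour. By homogeneity it suffices to find suitable sizes of the blocks, which Hilbert's cube
lemma provides. -/
theorem exists_block_stable_first (R : ℕ) (hR : 2 ≤ R) (m : ℕ) :
    ∃ n ≤ (grzegorczykE 2)^[7] (m + R), ∀ (κ : Type) [Fintype κ], Fintype.card κ ≤ R →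
      ∀ c : Finset ℕ → κ, ∃ F : ℕ → Finset ℕ, IsBlockSeq F (m + 1) n ∧
        ∀ I ⊆ Finset.range m, c ((insert 0 (I.image Nat.succ)).biUnion F) = c (F 0) := by
  classical
  obtain ⟨G, hG, hcube⟩ := exists_hilbertCube R m
  obtain ⟨n, hn, hhom⟩ := exists_homogeneous R hR G
  refine ⟨n, ?_, fun κ _ hκ c => ?_⟩
  · have hdbl := two_mul_le_grzegorczykE
    have hmono := grzegorczykE_mono 2
    set X := m + R
    have hx1 := hdbl X
    have hx2 := hdbl (grzegorczykE 2 X)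
    have h1 : G ≤ grzegorczykE 2 (grzegorczykE 2 (grzegorczykE 2 X)) :=
      hG.trans (hmono (by omega))
    have hx3 := hdbl (grzegorczykE 2 (grzegorczykE 2 X))
    set Y := grzegorczykE 2 (grzegorczykE 2 (grzegorczykE 2 X))
    have hy1 := hdbl Y
    have hy2 := hdbl (grzegorczykE 2 Y)
    have hy3 := hdbl (grzegorczykE 2 (grzegorczykE 2 Y))
    exact hn.trans (hmono (show 6 * G + R ≤
      grzegorczykE 2 (grzegorczykE 2 (grzegorczykE 2 Y)) by omega))
  · obtain ⟨h, hhn, hhlt, hcol⟩ := hhom κ hκ c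
    obtain ⟨a, d, ha, hd, hsum, hmono⟩ := hcube κ hκ fun g => c ((Finset.range g).image h)
    -- consecutive intervals of lengths `a, d 0, …, d (m - 1)`
    set p : ℕ → ℕ := fun i => a + ∑ j ∈ Finset.range i, d j with hp
    have hp1 : ∀ i, p (i + 1) = p i + d i := fun i => by
      simp only [hp, Finset.sum_range_succ]; omega
    have hpm : Monotone p := monotone_nat_of_le_succ fun i => by rw [hp1]; omega
    have hpG : p m ≤ G := hsum
    set K : ℕ → Finset ℕ := fun i => Nat.casesOn i (Finset.range a)
      (fun i => Finset.Ico (p i) (p (i + 1)))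
    have hK0 : K 0 = Finset.range a := rfl
    have hKlt : ∀ i, ∀ x ∈ K i, x < p i := by
      intro i x hx
      cases i with
      | zero => simpa [hp] using Finset.mem_range.1 hx
      | succ i => exact (Finset.mem_Ico.1 hx).2
    have hKblock : IsBlockSeq K (m + 1) G := by
      refine ⟨fun i hi => ?_, fun i hi x hx => ?_, fun i j hij hj x hx y hy => ?_⟩
      · cases i with
        | zero => exact ⟨0, Finset.mem_range.2 ha⟩
        | succ i =>
          have := hd i (by omega)
          exact ⟨p i, Finset.mem_Ico.2 ⟨le_rfl, by rw [hp1]; omega⟩⟩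
      · have h1 := hKlt i x hx
        have h2 : p i ≤ p m := hpm (by omega)
        exact Finset.mem_range.2 (by omega)
      · obtain ⟨j, rfl⟩ : ∃ j', j = j' + 1 := ⟨j - 1, by omega⟩
        have h1 := hKlt i x hx
        have h2 : p i ≤ p j := hpm (by omega)
        have h3 := (Finset.mem_Ico.1 hy).1
        omega
    have hcard : ∀ I : Finset ℕ, I ⊆ Finset.range m →
        ((insert 0 (I.image Nat.succ)).biUnion K).card = a + ∑ i ∈ I, d i := by
      intro I hI
      have hsub : ∀ i ∈ insert 0 (I.image Nat.succ), i < m + 1 := by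
        intro i hi
        rcases Finset.mem_insert.1 hi with rfl | hi
        · omega
        · obtain ⟨j, hj, rfl⟩ := Finset.mem_image.1 hi
          have := Finset.mem_range.1 (hI hj)
          omega
      rw [Finset.card_biUnion]
      · rw [Finset.sum_insert (by simp), Finset.sum_image (fun x _ y _ h => Nat.succ_injective h)]
        congr 1
        · rw [hK0, Finset.card_range]
        · refine Finset.sum_congr rfl fun i _ => ?_
          change (Finset.Ico (p i) (p (i + 1))).card = _
          rw [Nat.card_Ico, hp1]; omega
      · intro i hi j hj hij
        rw [Function.onFun, Finset.disjoint_left]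
        intro x hxi hxj
        rcases lt_or_gt_of_ne hij with h | h
        · exact lt_irrefl _ (hKblock.lt i j h (hsub j hj) x hxi x hxj)
        · exact lt_irrefl _ (hKblock.lt j i h (hsub i hi) x hxj x hxi)
    refine ⟨fun j => (K j).biUnion fun i => {h i},
      (IsBlockSeq.singleton hhn hhlt).comp hKblock, fun I hI => ?_⟩
    rw [← Finset.biUnion_biUnion]
    simp only [Finset.biUnion_singleton]
    have hle : a + ∑ i ∈ I, d i ≤ G :=
      (Nat.add_le_add_left (Finset.sum_le_sum_of_subset hI) a).trans hsum
    have h1 := hmono I hI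
    rw [hK0, ← h1]
    refine hcol _ ?_ _ ?_ ?_
    · refine Finset.biUnion_subset.2 fun i hi => hKblock.subset i ?_
      rcases Finset.mem_insert.1 hi with rfl | hi
      · omega
      · obtain ⟨j, hj, rfl⟩ := Finset.mem_image.1 hi
        have := Finset.mem_range.1 (hI hj)
        omega
    · exact Finset.range_subset_range.2 hle
    · rw [hcard I hI, Finset.card_range]

/-- Iterating `exists_block_stable_first` gives blocks for which the colour of a union depends only
on its first block. -/
theorem exists_block_min_determined (R : ℕ) (hR : 2 ≤ R) (m : ℕ) :
    ∃ n, n + R ≤ (grzegorczykE 2)^[8 * m] R ∧ ∀ (κ : Type) [Fintype κ], Fintype.card κ ≤ R →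
      ∀ c : Finset ℕ → κ, ∃ F : ℕ → Finset ℕ, IsBlockSeq F m n ∧ ∃ d : ℕ → κ,
        ∀ i < m, ∀ I ⊆ Finset.range m, (∀ j ∈ I, i < j) → c ((insert i I).biUnion F) = d i := by
  classical
  induction m with
  | zero =>
    refine ⟨0, by simp, fun κ _ _ c => ⟨fun _ => ∅, ⟨?_, ?_, ?_⟩, fun _ => c ∅, ?_⟩⟩ <;> simp
  | succ m ih =>
    obtain ⟨n', hn', ih⟩ := ih
    obtain ⟨n, hn, hstab⟩ := exists_block_stable_first R hR n'
    refine ⟨n, ?_, fun κ _ hκ c => ?_⟩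
    · rw [show 8 * (m + 1) = (1 + 7) + 8 * m by ring, Function.iterate_add_apply,
        Function.iterate_add_apply]
      set X := (grzegorczykE 2)^[8 * m] R
      have h1 : n ≤ (grzegorczykE 2)^[7] X := hn.trans (iterate_grzegorczykE_mono 2 7 hn')
      have h2 : R ≤ (grzegorczykE 2)^[7] X :=
        le_trans (le_trans (by omega) hn') (le_iterate_grzegorczykE 2 7 X)
      set Y := (grzegorczykE 2)^[7] X
      have h3 := two_mul_le_grzegorczykE Y
      exact le_trans (by omega) h3
    · obtain ⟨F, hF, hF0⟩ := hstab κ hκ c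
      obtain ⟨G, hG, d, hd⟩ := ih κ hκ fun A => c ((A.image Nat.succ).biUnion F)
      set K : ℕ → Finset ℕ := fun i => Nat.casesOn i {0} (fun i => (G i).image Nat.succ)
      have hKimg : ∀ J : Finset ℕ, (J.image Nat.succ).biUnion K =
          (J.biUnion G).image Nat.succ := fun J => by
        rw [Finset.image_biUnion, Finset.biUnion_image]
      -- a set of positive integers is the set of successors of a set
      have hpred : ∀ i, ∀ I ⊆ Finset.range (m + 1), (∀ j ∈ I, i < j) →
          ∃ J ⊆ Finset.range m, I = J.image Nat.succ := by
        intro i I hI hi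
        have hJ : ∀ j ∈ I, (j - 1) + 1 = j := fun j hj => by have := hi j hj; omega
        refine ⟨I.image Nat.pred, Finset.image_subset_iff.2 fun j hj => ?_, ?_⟩
        · have := Finset.mem_range.1 (hI hj)
          have := hJ j hj
          rw [Finset.mem_range, Nat.pred_eq_sub_one]; omega
        · rw [Finset.image_image]
          ext j
          rw [Finset.mem_image]
          exact ⟨fun hj => ⟨j, hj, hJ j hj⟩, fun ⟨j', hj', h⟩ => by
            rw [← h, Function.comp, Nat.pred_eq_sub_one, Nat.succ_eq_add_one, hJ j' hj']
            exact hj'⟩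
      have hKblock : IsBlockSeq K (m + 1) (n' + 1) := by
        refine ⟨fun i hi => ?_, fun i hi x hx => ?_, fun i j hij hj x hx y hy => ?_⟩
        · cases i with
          | zero => exact Finset.singleton_nonempty 0
          | succ i => exact (hG.nonempty i (by omega)).image _
        · cases i with
          | zero => simp [Finset.mem_singleton.1 hx]
          | succ i =>
            obtain ⟨x', hx', rfl⟩ := Finset.mem_image.1 hx
            have := Finset.mem_range.1 (hG.subset i (by omega) hx')
            exact Finset.mem_range.2 (by omega)
        · obtain ⟨j, rfl⟩ : ∃ j', j = j' + 1 := ⟨j - 1, by omega⟩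
          obtain ⟨y', hy', rfl⟩ := Finset.mem_image.1 hy
          cases i with
          | zero => rw [Finset.mem_singleton.1 hx]; omega
          | succ i =>
            obtain ⟨x', hx', rfl⟩ := Finset.mem_image.1 hx
            exact Nat.succ_lt_succ (hG.lt i j (by omega) (by omega) x' hx' y' hy')
      refine ⟨fun j => (K j).biUnion F, hF.comp hKblock,
        fun i => Nat.casesOn i (c (F 0)) d, fun i hi I hI hiI => ?_⟩
      rw [← Finset.biUnion_biUnion]
      obtain ⟨J, hJ, rfl⟩ := hpred i I hI hiI
      cases i with
      | zero =>
        rw [Finset.biUnion_insert, hKimg]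
        refine hF0 (J.biUnion G) (Finset.biUnion_subset.2 fun j hj => ?_)
        exact hG.subset j (Finset.mem_range.1 (hJ hj))
      | succ i =>
        rw [← Nat.succ_eq_add_one, ← Finset.image_insert, hKimg]
        refine hd i (by omega) J hJ fun j hj => ?_
        exact Nat.lt_of_succ_lt_succ (hiI _ (Finset.mem_image_of_mem _ hj))

/-- The finite unions theorem in block position. -/
theorem exists_block_monochromatic (R : ℕ) (hR : 2 ≤ R) (m : ℕ) :
    ∃ n ≤ (grzegorczykE 2)^[8 * (R * m)] R, ∀ (κ : Type) [Fintype κ], Fintype.card κ ≤ R →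
      ∀ c : Finset ℕ → κ, ∃ F : ℕ → Finset ℕ, IsBlockSeq F m n ∧ ∃ col : κ,
        ∀ I ⊆ Finset.range m, I.Nonempty → c (I.biUnion F) = col := by
  classical
  obtain ⟨n, hn, hmin⟩ := exists_block_min_determined R hR (R * m)
  refine ⟨n, by omega, fun κ _ hκ c => ?_⟩
  obtain ⟨F, hF, d, hd⟩ := hmin κ hκ c
  obtain ⟨col, -, hcol⟩ := Finset.exists_le_card_fiber_of_mul_le_card_of_maps_to
    (s := Finset.range (R * m)) (t := Finset.univ) (f := d) (n := m)
    (by simp) ⟨c ∅, by simp⟩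
    (by rw [Finset.card_univ, Finset.card_range]; exact Nat.mul_le_mul_right _ hκ)
  obtain ⟨T, hT, hTm⟩ := Finset.exists_subset_card_eq hcol
  set h : ℕ → ℕ := fun i => if hi : i < m then T.orderEmbOfFin hTm ⟨i, hi⟩ else 0 with hh
  have hval : ∀ i (hi : i < m), h i = T.orderEmbOfFin hTm ⟨i, hi⟩ := fun i hi => by simp [hh, hi]
  have hmem : ∀ i < m, h i < R * m ∧ d (h i) = col := fun i hi => by
    rw [hval i hi]
    have := Finset.mem_filter.1 (hT (T.orderEmbOfFin_mem hTm ⟨i, hi⟩))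
    exact ⟨Finset.mem_range.1 this.1, this.2⟩
  have hlt : ∀ i j, i < j → j < m → h i < h j := fun i j hij hj => by
    rw [hval i (hij.trans hj), hval j hj]
    exact (T.orderEmbOfFin hTm).strictMono hij
  refine ⟨_, hF.comp (IsBlockSeq.singleton (fun i hi => (hmem i hi).1) hlt), col,
    fun I hI hne => ?_⟩
  rw [← Finset.biUnion_biUnion, Finset.biUnion_singleton]
  have hminI := I.min'_mem hne
  have hi₀ := hmem _ (Finset.mem_range.1 (hI hminI))
  rw [← Finset.insert_erase hminI, Finset.image_insert, hd _ hi₀.1, hi₀.2]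
  · refine Finset.image_subset_iff.2 fun j hj => Finset.mem_range.2 ?_
    exact (hmem j (Finset.mem_range.1 (hI (Finset.mem_of_mem_erase hj)))).1
  · intro j hj
    obtain ⟨i, hi, rfl⟩ := Finset.mem_image.1 hj
    have hiI := Finset.mem_of_mem_erase hi
    exact hlt _ _ (lt_of_le_of_ne (I.min'_le i hiI) (Finset.ne_of_mem_erase hi).symm)
      (Finset.mem_range.1 (hI hiI))

/-! ### Substitution into variable words -/

namespace VarWord

variable {k m n : ℕ}

/-- Substitution of arbitrary symbols, letters or the variable, for the variables of `w`. Unlike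
in `VarWord.subst`, no symbol is required to be the variable. -/
def eval (w : VarWord k m n) (x : Fin m → Fin k ⊕ Fin 1) : Fin n → Fin k ⊕ Fin 1 :=
  fun i => Sum.elim Sum.inl x (w.seq i)

theorem ext_seq {u v : VarWord k m n} (h : u.seq = v.seq) : u = v := by
  cases u; cases v; cases h; rfl

theorem eval_subst {l : ℕ} (w : VarWord k m n) (v : VarWord k l m)
    (x : Fin l → Fin k ⊕ Fin 1) : (w.subst v).eval x = w.eval (v.eval x) := by
  funext i
  simp only [eval, subst]
  cases w.seq i <;> rfl

theorem exists_eval_eq_inr (w : VarWord k m n) {x : Fin m → Fin k ⊕ Fin 1}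
    (hx : ∃ i, x i = Sum.inr 0) : ∃ i, w.eval x i = Sum.inr 0 := by
  obtain ⟨p, hp⟩ := hx
  obtain ⟨i, hi⟩ := w.occurs p
  exact ⟨i, by simp [eval, hi, hp]⟩

/-- A one-dimensional variable word is a sequence in which the variable occurs. -/
def ofOccurs (u : Fin n → Fin k ⊕ Fin 1) (hu : ∃ i, u i = Sum.inr 0) : VarWord k 1 n where
  seq := u
  occurs j := by rwa [Subsingleton.elim j 0]
  block j j' h := absurd h (by rw [Subsingleton.elim j j']; exact lt_irrefl _)

/-- The word `v_0 v_1 ⋯ v_{m-1} a a ⋯ a` of length `n`. -/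
def initialVars (h : m ≤ n) (a : Fin k) : VarWord k m n where
  seq i := if hi : (i : ℕ) < m then Sum.inr ⟨i, hi⟩ else Sum.inl a
  occurs j := ⟨⟨j, j.2.trans_le h⟩, by simp⟩
  block j j' hjj i i' hi hi' := by
    split_ifs at hi hi' with h1 h2
    cases hi; cases hi'
    exact hjj

/-- Renaming of the letters of a variable word. -/
def mapLetters {k' : ℕ} (f : Fin k → Fin k') (w : VarWord k m n) : VarWord k' m n where
  seq i := Sum.map f id (w.seq i)
  occurs j := by
    obtain ⟨i, hi⟩ := w.occurs j
    exact ⟨i, by simp [hi]⟩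
  block j j' hjj i i' hi hi' := by
    rcases hp : w.seq i with a | p
    · simp [hp] at hi
    rcases hq : w.seq i' with a | q
    · simp [hq] at hi'
    simp only [hp, Sum.map_inr, id, Sum.inr.injEq] at hi
    simp only [hq, Sum.map_inr, id, Sum.inr.injEq] at hi'
    exact w.block j j' hjj i i' (hi ▸ hp) (hi' ▸ hq)

/-- The concatenation of `w` with the block `a ⋯ a v b ⋯ b` of length `L`, where `v` is a new
variable occupying the positions `s, …, t - 1` of the block. -/
def appendLine {L s t : ℕ} (w : VarWord k m n) (a b : Fin k) (hst : s < t) (htL : t ≤ L) :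
    VarWord k (m + 1) (n + L) where
  seq := Fin.append (fun i => Sum.map id Fin.castSucc (w.seq i)) fun i =>
    if (i : ℕ) < s then Sum.inl a else if (i : ℕ) < t then Sum.inr (Fin.last m) else Sum.inl b
  occurs j := by
    refine Fin.lastCases ?_ (fun j => ?_) j
    · exact ⟨Fin.natAdd n ⟨s, by omega⟩, by rw [Fin.append_right]; simp [hst]⟩
    · obtain ⟨i, hi⟩ := w.occurs j
      exact ⟨Fin.castAdd L i, by rw [Fin.append_left]; simp [hi]⟩
  block j j' hjj i i' := by
    -- in the appended block only the last variable occurs, in the old word it does not occur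
    have hright : ∀ (i : Fin L) (j : Fin (m + 1)),
        (if (i : ℕ) < s then Sum.inl a else if (i : ℕ) < t then Sum.inr (Fin.last m)
          else Sum.inl b : Fin k ⊕ Fin (m + 1)) = Sum.inr j → j = Fin.last m := by
      intro i j h
      split_ifs at h
      exact (Sum.inr.inj h).symm
    have hleft : ∀ (i : Fin n) (j : Fin (m + 1)),
        Sum.map id Fin.castSucc (w.seq i) = (Sum.inr j : Fin k ⊕ Fin (m + 1)) →
          ∃ p, w.seq i = Sum.inr p ∧ j = Fin.castSucc p := by
      intro i j h
      rcases hp : w.seq i with a | p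
      · simp [hp] at h
      · exact ⟨p, rfl, by simpa [hp, eq_comm] using h⟩
    refine Fin.addCases (fun i => ?_) (fun i => ?_) i <;>
      refine Fin.addCases (fun i' => ?_) (fun i' => ?_) i' <;>
      simp only [Fin.append_left, Fin.append_right] <;> intro hi hi'
    · obtain ⟨p, hp, rfl⟩ := hleft i j hi
      obtain ⟨q, hq, rfl⟩ := hleft i' j' hi'
      exact w.block p q hjj i i' hp hq
    · rw [Fin.lt_def, Fin.val_castAdd, Fin.val_natAdd]
      omega
    · rw [hright i j hi] at hjj
      exact absurd hjj (Fin.le_last j').not_gt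
    · rw [hright i j hi, hright i' j' hi'] at hjj
      exact absurd hjj (lt_irrefl _)

theorem eval_appendLine {L s t : ℕ} (w : VarWord k m n) (a b : Fin k) (hst : s < t) (htL : t ≤ L)
    (x : Fin (m + 1) → Fin k ⊕ Fin 1) :
    (w.appendLine a b hst htL).eval x = Fin.append (w.eval fun i => x i.castSucc)
      fun i : Fin L => if (i : ℕ) < s then Sum.inl a else
        if (i : ℕ) < t then x (Fin.last m) else Sum.inl b := by
  funext i
  refine Fin.addCases (fun i => ?_) (fun i => ?_) i
  · simp only [eval, appendLine, Fin.append_left]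
    cases w.seq i <;> rfl
  · simp only [eval, appendLine, Fin.append_right]
    split_ifs <;> rfl

end VarWord

/-! ### Insensitivity to a pair of letters -/

/-- Shelah's insensitivity lemma: every colouring of words becomes, on a suitable subspace,
invariant under the replacement of all letters `b` by `a`. -/
theorem exists_insensitive {k : ℕ} (a b : Fin k) (M : ℕ) :
    ∀ R : ℕ, ∃ n ≤ (grzegorczykE 1)^[5 * M] (R + (k + 1)), ∀ (κ : Type) [Fintype κ],
      Fintype.card κ ≤ R → ∀ c : (Fin n → Fin k ⊕ Fin 1) → κ, ∃ w : VarWord k M n,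
        ∀ x : Fin M → Fin k ⊕ Fin 1,
          c (w.eval fun i => if x i = Sum.inl b then Sum.inl a else x i) = c (w.eval x) := by
  classical
  induction M with
  | zero =>
    refine fun R => ⟨0, Nat.zero_le _, fun κ _ _ c =>
      ⟨⟨Fin.elim0, fun j => j.elim0, fun j => j.elim0⟩, fun x => ?_⟩⟩
    congr 1
    funext i
    exact i.elim0
  | succ M ih =>
    intro R
    obtain ⟨n, hn, ih⟩ := ih (R ^ (k + 1))
    set L := R ^ (k + 1) ^ n
    refine ⟨n + L, ?_, fun κ _ hκ c => ?_⟩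
    · set X := R + (k + 1)
      have hX1 : R ^ (k + 1) + (k + 1) ≤ (grzegorczykE 1)^[2] X :=
        add_le_grzegorczykE (pow_le_grzegorczykE (by omega) (by omega))
          (le_trans (by omega) (lt_grzegorczykE 1 X).le)
      have hnY := hn.trans (iterate_grzegorczykE_mono 1 (5 * M) hX1)
      rw [← Function.iterate_add_apply] at hnY
      rw [show 5 * (M + 1) = 3 + (5 * M + 2) by ring, Function.iterate_add_apply]
      set Y := (grzegorczykE 1)^[5 * M + 2] X
      have hXY : X ≤ Y := le_iterate_grzegorczykE 1 _ X
      have hY1 := (lt_grzegorczykE 1 Y).le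
      have h1 : L ≤ grzegorczykE 1 (grzegorczykE 1 Y) :=
        pow_le_grzegorczykE (by omega) (pow_le_grzegorczykE (by omega) hnY)
      have hY2 := (lt_grzegorczykE 1 (grzegorczykE 1 Y)).le
      exact add_le_grzegorczykE (by omega) h1
    · -- two of the `L + 1` words `a ⋯ a b ⋯ b` have the same colour after every prefix
      set thr : ℕ → Fin L → Fin k ⊕ Fin 1 := fun s i => if (i : ℕ) < s then Sum.inl a
        else Sum.inl b with hthr
      obtain ⟨s, hs, t, ht, hne, heq⟩ : ∃ s ∈ Finset.range (L + 1), ∃ t ∈ Finset.range (L + 1),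
          s ≠ t ∧ (fun u : Fin n → Fin k ⊕ Fin 1 => c (Fin.append u (thr s))) =
            fun u : Fin n → Fin k ⊕ Fin 1 => c (Fin.append u (thr t)) := by
        refine Finset.exists_ne_map_eq_of_card_lt_of_maps_to
          (f := fun s => fun u : Fin n → Fin k ⊕ Fin 1 => c (Fin.append u (thr s)))
          (t := Finset.univ) ?_ (by simp)
        rw [Finset.card_univ, Fintype.card_fun, Fintype.card_fun, Fintype.card_sum,
          Fintype.card_fin, Fintype.card_fin, Fintype.card_fin, Finset.card_range]
        exact Nat.lt_succ_of_le (Nat.pow_le_pow_left hκ _)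
      wlog hst : s < t generalizing s t
      · exact this t ht s hs hne.symm heq.symm (by omega)
      have htL : t ≤ L := by rw [Finset.mem_range] at ht; omega
      set line : Fin k ⊕ Fin 1 → Fin L → Fin k ⊕ Fin 1 := fun σ i =>
        if (i : ℕ) < s then Sum.inl a else if (i : ℕ) < t then σ else Sum.inl b with hline
      have hla : line (Sum.inl a) = thr t := by
        funext i
        simp only [hline, hthr]
        split_ifs <;> first | rfl | omega
      have hlb : line (Sum.inl b) = thr s := by
        funext i
        simp only [hline, hthr]
        split_ifs <;> rfl
      obtain ⟨w, hw⟩ := ih (Fin k ⊕ Fin 1 → κ)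
        (by
          rw [Fintype.card_fun, Fintype.card_sum, Fintype.card_fin, Fintype.card_fin]
          exact Nat.pow_le_pow_left hκ _)
        fun u σ => c (Fin.append u (line σ))
      refine ⟨w.appendLine a b hst htL, fun x => ?_⟩
      rw [VarWord.eval_appendLine, VarWord.eval_appendLine]
      have h1 := congrFun (hw fun i => x i.castSucc)
        (if x (Fin.last M) = Sum.inl b then Sum.inl a else x (Fin.last M))
      refine h1.trans ?_
      change c (Fin.append _ (line _)) = c (Fin.append _ (line _))
      split_ifs with h
      · rw [h, hla, hlb]
        exact (congrFun heq _).symm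
      · rfl

/-! ### Monochromatic subspaces -/

/-- Every `r`-colouring of all words of length `n`, with or without the variable, is constant
on the variable words reduced by some `m`-dimensional variable word of length `n`. -/
def HasMonoSubspace (k m r n : ℕ) : Prop :=
  ∀ c : (Fin n → Fin k ⊕ Fin 1) → Fin r, ∃ w : VarWord k m n, ∃ col : Fin r,
    ∀ x : Fin m → Fin k ⊕ Fin 1, (∃ i, x i = Sum.inr 0) → c (w.eval x) = col

theorem HasMonoSubspace.mono {k m r n n' : ℕ} (hk : 0 < k) (h : HasMonoSubspace k m r n)
    (hn : n ≤ n') : HasMonoSubspace k m r n' := by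
  intro c
  set v : VarWord k n n' := VarWord.initialVars hn ⟨0, hk⟩
  obtain ⟨w, col, hw⟩ := h fun u => c (v.eval u)
  exact ⟨v.subst w, col, fun x hx => by rw [VarWord.eval_subst]; exact hw x hx⟩

theorem HasMonoSubspace.grProperty {k m r n₀ : ℕ} (hk : 0 < k) (hr : 0 < r)
    (h : HasMonoSubspace k m r n₀) : GRProperty k m r n₀ := by
  classical
  intro n hn c
  obtain ⟨w, col, hw⟩ := h.mono hk hn fun u =>
    if hu : ∃ i, u i = Sum.inr 0 then c (VarWord.ofOccurs u hu) else ⟨0, hr⟩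
  refine ⟨w, col, ?_⟩
  rintro u ⟨x, rfl⟩
  have hx := x.occurs 0
  have h1 := hw x.seq hx
  rw [dif_pos (w.exists_eval_eq_inr hx)] at h1
  rw [← h1]
  exact congrArg c (VarWord.ext_seq rfl)

/-- Over a one-letter alphabet, words are sets of positions, and the result is the finite unions
theorem. -/
theorem exists_hasMonoSubspace_one (m r : ℕ) (hr : 0 < r) :
    ∃ n ≤ (grzegorczykE 2)^[8 * ((r + 1) * m)] (r + 1), HasMonoSubspace 1 m r n := by
  classical
  obtain ⟨n, hn, h⟩ := exists_block_monochromatic (r + 1) (by omega) m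
  refine ⟨n, hn, fun c => ?_⟩
  obtain ⟨F, hF, col, hcol⟩ := h (Fin r) (by simp) fun A =>
    c fun i => if (i : ℕ) ∈ A then Sum.inr 0 else Sum.inl 0
  have huniq : ∀ (j j' : Fin m) (i : ℕ), i ∈ F j → i ∈ F j' → j = j' := by
    intro j j' i hj hj'
    rcases lt_trichotomy j j' with h | h | h
    · exact absurd (hF.lt j j' h j'.2 i hj i hj') (lt_irrefl _)
    · exact h
    · exact absurd (hF.lt j' j h j.2 i hj' i hj) (lt_irrefl _)
  set seq : Fin n → Fin 1 ⊕ Fin m := fun i =>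
    if h : ∃ j : Fin m, (i : ℕ) ∈ F j then Sum.inr h.choose else Sum.inl 0 with hseq
  have hseq_iff : ∀ i j, seq i = Sum.inr j ↔ (i : ℕ) ∈ F j := by
    intro i j
    simp only [hseq]
    split_ifs with h
    · rw [Sum.inr.injEq]
      exact ⟨fun h' => h' ▸ h.choose_spec, fun h' => huniq _ _ _ h.choose_spec h'⟩
    · simp only [false_iff]
      exact fun h' => h ⟨j, h'⟩
  let w : VarWord 1 m n :=
    { seq := seq
      occurs := fun j => by
        obtain ⟨i, hi⟩ := hF.nonempty j j.2
        exact ⟨⟨i, Finset.mem_range.1 (hF.subset j j.2 hi)⟩, (hseq_iff _ _).2 hi⟩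
      block := fun j j' hjj i i' hi hi' =>
        hF.lt j j' hjj j'.2 i ((hseq_iff i j).1 hi) i' ((hseq_iff i' j').1 hi') }
  refine ⟨w, col, fun x hx => ?_⟩
  set I : Finset ℕ := (Finset.univ.filter fun j => x j = Sum.inr 0).image Fin.val with hI
  have hIr : I ⊆ Finset.range m :=
    Finset.image_subset_iff.2 fun j _ => Finset.mem_range.2 j.2
  have hIne : I.Nonempty := by
    obtain ⟨j, hj⟩ := hx
    exact ⟨j, Finset.mem_image_of_mem _ (by simp [hj])⟩
  rw [← hcol I hIr hIne]
  congr 1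
  funext i
  have hmem : (i : ℕ) ∈ I.biUnion F ↔ ∃ j, x j = Sum.inr 0 ∧ (i : ℕ) ∈ F j := by
    simp [hI, Finset.mem_biUnion]
  have hletter : ∀ y : Fin 1 ⊕ Fin 1, y ≠ Sum.inr 0 → y = Sum.inl 0 := by decide
  change Sum.elim Sum.inl x (seq i) = _
  rcases hs : seq i with p | j
  · rw [if_neg]
    · simp [Subsingleton.elim p 0]
    · rw [hmem]
      rintro ⟨j, -, hj⟩
      rw [← hseq_iff, hs] at hj
      simp at hj
  · have hj := (hseq_iff i j).1 hs
    rw [Sum.elim_inr]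
    split_ifs with hi
    · obtain ⟨j', hj', hij'⟩ := hmem.1 hi
      rw [huniq j j' i hj hij', hj']
    · exact hletter _ fun h => hi (hmem.2 ⟨j, h, hj⟩)

/-- Adding a letter to a nonempty alphabet: on a subspace where the new letter may be replaced by an
old one, the colouring is determined by the words over the old alphabet. -/
theorem HasMonoSubspace.exists_succ {k m r M : ℕ} (hk : 0 < k) (h : HasMonoSubspace k m r M) :
    ∃ n ≤ grzegorczykE 2 (5 * M + r + k + 2), HasMonoSubspace (k + 1) m r n := by
  classical
  obtain ⟨n, hn, hins⟩ := exists_insensitive (Fin.castSucc (⟨0, hk⟩ : Fin k)) (Fin.last k) M r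
  refine ⟨n, hn.trans ((iterate_grzegorczykE_le 1 _ _).trans
    (grzegorczykE_mono 2 (by omega))), fun c => ?_⟩
  obtain ⟨w, hw⟩ := hins (Fin r) (by simp) c
  obtain ⟨v, col, hv⟩ := h fun u => c (w.eval fun i => Sum.map Fin.castSucc id (u i))
  refine ⟨w.subst (v.mapLetters Fin.castSucc), col, fun x hx => ?_⟩
  -- the retraction of the larger alphabet that sends the new letter to `0`
  set p : Fin (k + 1) → Fin k := fun i => Fin.lastCases ⟨0, hk⟩ id i with hp
  have hpcast : ∀ i : Fin k, p i.castSucc = i := fun i => by simp [hp]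
  have hplast : p (Fin.last k) = ⟨0, hk⟩ := by simp [hp]
  have hpp : ∀ y : Fin (k + 1) ⊕ Fin 1, Sum.map (Fin.castSucc ∘ p) id y =
      if y = Sum.inl (Fin.last k) then Sum.inl (Fin.castSucc ⟨0, hk⟩) else y := by
    rintro (a | b)
    · refine Fin.lastCases ?_ (fun a => ?_) a
      · simp [hplast]
      · simp [hpcast, (Fin.castSucc_lt_last a).ne]
    · simp
  rw [VarWord.eval_subst, ← hw]
  have hx' : ∃ i, Sum.map p id (x i) = Sum.inr 0 := by
    obtain ⟨i, hi⟩ := hx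
    exact ⟨i, by simp [hi]⟩
  rw [← hv _ hx']
  congr 2
  funext i
  rw [← hpp]
  simp only [VarWord.eval, VarWord.mapLetters]
  rcases v.seq i with a | j
  · simp [hpcast]
  · simp [Sum.map_map]

/-- The tower-type bounds of the successive steps, collected. -/
theorem exists_hasMonoSubspace (m r : ℕ) (hr : 0 < r) (j : ℕ) :
    ∃ n ≤ (grzegorczykE 2)^[8 * ((r + 1) * m) + 4 * j] (r + 1 + j),
      HasMonoSubspace (j + 1) m r n := by
  induction j with
  | zero => exact exists_hasMonoSubspace_one m r hr
  | succ j ih =>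
    obtain ⟨M, hM, h⟩ := ih
    obtain ⟨n, hn, h'⟩ := h.exists_succ j.succ_pos
    refine ⟨n, ?_, h'⟩
    set t := 8 * ((r + 1) * m) + 4 * j
    set X := (grzegorczykE 2)^[t] (r + 1 + j) with hX
    have hrX : r + 1 + j ≤ X := le_iterate_grzegorczykE 2 t _
    have h1 := two_mul_le_grzegorczykE X
    have h2 := two_mul_le_grzegorczykE (grzegorczykE 2 X)
    have h3 := two_mul_le_grzegorczykE (grzegorczykE 2 (grzegorczykE 2 X))
    have h4 : n ≤ (grzegorczykE 2)^[4] X :=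
      hn.trans (grzegorczykE_mono 2 (show 5 * M + r + (j + 1) + 2 ≤
        grzegorczykE 2 (grzegorczykE 2 (grzegorczykE 2 X)) by omega))
    refine h4.trans ?_
    rw [hX, ← Function.iterate_add_apply, show 4 + t = t + 4 * 1 by ring,
      show 8 * ((r + 1) * m) + 4 * (j + 1) = t + 4 * 1 by ring]
    exact iterate_grzegorczykE_mono 2 _ (by omega)

/-! ### The bounding function -/

theorem primrec_grzegorczykE (i : ℕ) : Primrec (grzegorczykE i) := by
  induction i with
  | zero =>
    refine (Primrec.nat_add.comp (Primrec.nat_mul.comp .id .id) (.const 2)).of_eq fun x => ?_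
    simp [grzegorczykE, sq]
  | succ i ih =>
    refine (Primrec.nat_rec₁ 2 (f := fun _ y => grzegorczykE i y) (ih.comp .snd)).of_eq fun x => ?_
    induction x with
    | zero => simp [grzegorczykE]
    | succ x hx => simp only [grzegorczykE, ← hx]

/-- `E_4(E_1(3 (k + m + r)))`, as a function of the vector `![k, m, r]`; here `E_1(x) = x² + 2`
serves as a quadratic polynomial. -/
def grBound (v : Fin 3 → ℕ) : ℕ :=
  grzegorczykE 3 (grzegorczykE 0 ((v 0 + v 1 + v 2) + ((v 0 + v 1 + v 2) + (v 0 + v 1 + v 2))))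

theorem primrec_grBound : Primrec grBound := by
  have hv : ∀ i : Fin 3, Primrec fun v : Fin 3 → ℕ => v i := fun i =>
    Primrec.fin_app.comp .id (.const i)
  have hs : Primrec fun v : Fin 3 → ℕ => v 0 + v 1 + v 2 :=
    Primrec.nat_add.comp (Primrec.nat_add.comp (hv 0) (hv 1)) (hv 2)
  exact (primrec_grzegorczykE 3).comp ((primrec_grzegorczykE 0).comp
    (Primrec.nat_add.comp hs (Primrec.nat_add.comp hs hs)))

theorem Grzegorczyk.add_fun {N a : ℕ} (hN : 0 < N) {f g : (Fin a → ℕ) → ℕ}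
    (hf : Grzegorczyk N f) (hg : Grzegorczyk N g) : Grzegorczyk N fun v => f v + g v :=
  Grzegorczyk.comp (g := ![f, g]) (Grzegorczyk.add hN) (Fin.forall_fin_two.2 ⟨hf, hg⟩)

theorem Grzegorczyk.gen_comp {N a i : ℕ} (hi : i + 1 < N) {f : (Fin a → ℕ) → ℕ}
    (hf : Grzegorczyk N f) : Grzegorczyk N fun v => grzegorczykE i (f v) :=
  Grzegorczyk.comp (g := fun _ => f) (Grzegorczyk.gen i hi) fun _ => hf

theorem grzegorczyk_grBound : Grzegorczyk 5 grBound := by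
  have h0 : 0 < 5 := by norm_num
  have hs : Grzegorczyk 5 fun v : Fin 3 → ℕ => v 0 + v 1 + v 2 :=
    ((Grzegorczyk.proj 0).add_fun h0 (.proj 1)).add_fun h0 (.proj 2)
  exact ((hs.add_fun h0 (hs.add_fun h0 hs)).gen_comp (i := 0) (by norm_num)).gen_comp
    (i := 3) (by norm_num)

theorem grProperty_grBound {k m r : ℕ} (hk : 0 < k) (hr : 0 < r) :
    GRProperty k m r (grBound ![k, m, r]) := by
  obtain ⟨j, rfl⟩ : ∃ j, k = j + 1 := ⟨k - 1, by omega⟩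
  obtain ⟨n, hn, h⟩ := exists_hasMonoSubspace m r hr j
  refine (h.mono hk (hn.trans ((iterate_grzegorczykE_le 2 _ _).trans ?_))).grProperty hk hr
  refine grzegorczykE_mono 3 ?_
  simp only [grzegorczykE, Matrix.cons_val]
  nlinarith [Nat.zero_le (r * m), Nat.zero_le (j * m), Nat.zero_le (j * r), Nat.zero_le (m * m),
    Nat.zero_le (r * r), Nat.zero_le (j * j)]

theorem grBound_pos (v : Fin 3 → ℕ) : 0 < grBound v :=
  (Nat.zero_le _).trans_lt (lt_grzegorczykE _ _)

theorem theorem1 :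
    (∀ k r m : ℕ, 0 < k → 0 < r → 0 < m → ∃ n₀ : ℕ, 0 < n₀ ∧ GRProperty k m r n₀) ∧
    ∃ f : (Fin 3 → ℕ) → ℕ, Primrec f ∧ Grzegorczyk 5 f ∧
      ∀ k m r : ℕ, 0 < k → 0 < m → 0 < r → GR k m r ≤ f ![k, m, r] :=
  ⟨fun _ _ _ hk hr _ => ⟨_, grBound_pos _, grProperty_grBound hk hr⟩,
    grBound, primrec_grBound, grzegorczyk_grBound,
    fun _ _ _ hk _ hr => Nat.sInf_le ⟨grBound_pos _, grProperty_grBound hk hr⟩⟩
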